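/- An overpartition of $n$ is a partition of $n$ in which the first occurrence of each part may be overlined. Let $\overline{p}_{\mathrm{ev}}(n)$ denote the number of overpartitions of $n$ without repeated odd parts such that the odd parts are non-overlined and such that, if the smallest part is even and occurs only once, then it is also non-overlined. Then, as $n\to\infty$, $$\overline{p}_{\mathrm{ev}}(n)\sim \frac{e^{\pi\sqrt{2n/3}}}{4\sqrt{3}\,n}.$$ -/

import Mathlib

open Filter Asymptotics

/-- An overpartition of `n`: a partition of `n` in which the first occurrence of each part may be
overlined. It is encoded by the underlying partition together with the set of those part sizes
whose first occurrence is overlined. -/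
@[ext]
structure Overpartition (n : ℕ) where
  /-- the underlying partition of `n` -/
  toPartition : n.Partition
  /-- the part sizes whose first occurrence is overlined -/
  overlined : Finset ℕ
  overlined_subset : overlined ⊆ toPartition.parts.toFinset

namespace Overpartition

/-- An overpartition is the same as a partition with a subset of its set of part sizes. -/
def equivSigma (n : ℕ) :
    Overpartition n ≃ Σ p : n.Partition, {s : Finset ℕ // s ∈ p.parts.toFinset.powerset} where
  toFun o := ⟨o.toPartition, o.overlined, Finset.mem_powerset.2 o.overlined_subset⟩
  invFun x := ⟨x.1, x.2.1, Finset.mem_powerset.1 x.2.2⟩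
  left_inv _ := rfl
  right_inv _ := rfl

instance (n : ℕ) : Fintype (Overpartition n) := Fintype.ofEquiv _ (equivSigma n).symm

/-- `o.IsSmallest m` says that `m` is the smallest part of `o`. -/
def IsSmallest {n : ℕ} (o : Overpartition n) (m : ℕ) : Prop :=
  m ∈ o.toPartition.parts ∧ ∀ k ∈ o.toPartition.parts, m ≤ k

/-- The restriction defining `pEv`. -/
structure IsEv {n : ℕ} (o : Overpartition n) : Prop where
  /-- odd parts are not repeated -/
  odd_not_repeated : ∀ m ∈ o.toPartition.parts, Odd m → o.toPartition.parts.count m = 1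
  /-- odd parts are not overlined -/
  odd_not_overlined : ∀ m ∈ o.toPartition.parts, Odd m → m ∉ o.overlined
  /-- if the smallest part is even and occurs only once, then it is not overlined -/
  smallest_not_overlined : ∀ m, o.IsSmallest m → Even m →
    o.toPartition.parts.count m = 1 → m ∉ o.overlined

end Overpartition

/-- The number of overpartitions of `n` without repeated odd parts, in which the odd parts are
non-overlined, and in which the smallest part is non-overlined if it is even and occurs only
once. (The type being counted is finite.) -/
noncomputable def pEv (n : ℕ) : ℕ := Nat.card {o : Overpartition n // o.IsEv}

/-!
The overpartitions of `n` without repeated odd parts and without overlined odd parts have generating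
function `∏ (1 + q^(2k-1)) (1 + q^(2k)) / (1 - q^(2k)) = ∏ 1 / (1 - q^k)`, so there are exactly as
many of them as there are partitions of `n`. Call this number `a n` (`cardOddSimple n`). The extra
condition on the smallest part is asymptotically irrelevant: turning a missing part `1` into a part
`1`, and a part `1` into a non-overlined part `2`, injects these overpartitions of `n` into the ones
counted by `pEv (n + 1)`, whence `a n ≤ pEv (n + 1) ≤ a (n + 1)` (`cardOddSimple_le_pEv_succ`,
`pEv_le_cardOddSimple`). As the claimed main term changes by a factor tending to `1` from `n` to
`n + 1`, it remains to prove the Hardy–Ramanujan asymptotic for `a n` (`tendsto_cardOddSimple_div`).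

This is done by the circle method. Writing `E q = ∏ (1 - q^k)` (`eulerProd`), one has
`2 π a n = ∫ θ in -π..π, exp (n w) / E (exp (-w))` with `w = t + θ i`, for every `t > 0`
(`integral_eulerProd_inv_mul_exp`). Take `t = π / √(6 n)`, the saddle point, so that
`n = π² / (6 t²)`.

* On the major arc `|θ| ≤ 2 t`, put `θ = t u`. The transformation `τ ↦ -1 / τ` of the Dedekind eta
  function gives an exact formula for `1 / E (exp (-w))` in which the only large factor is
  `exp (π² / (6 w))` (`eulerProd_inv_transform`). The exponents combine to
  `π² / (3 t) - A u² / (1 + u i)` with `A = π² / (6 t)`, and after the substitution `v = √A u`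
  dominated convergence leaves the Gaussian integral (`tendsto_integral_majorArcFactor`).
* On the minor arc `2 t ≤ |θ| ≤ π`, expanding the logarithm of the product gives
  `|1 / E z| ≤ exp (1 / |1 - z| + (π² / 6 - 1) / t)`, and `|1 - z| ≥ 6 t / 5` there if `t` is
  small, so that the integrand is smaller than the main term by a factor `exp (-1 / (6 t))` up to
  powers of `t`
  (`norm_integral_minorArc_le`).
-/

/-! ### Reduction to the conditions on odd parts -/

namespace Overpartition

/-- The part of `IsEv` that concerns odd parts only: they are neither repeated nor overlined. -/
structure IsOddSimple {n : ℕ} (o : Overpartition n) : Prop where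
  odd_not_repeated : ∀ m ∈ o.toPartition.parts, Odd m → o.toPartition.parts.count m = 1
  odd_not_overlined : ∀ m ∈ o.toPartition.parts, Odd m → m ∉ o.overlined

lemma IsEv.isOddSimple {n : ℕ} {o : Overpartition n} (h : o.IsEv) : o.IsOddSimple :=
  ⟨h.odd_not_repeated, h.odd_not_overlined⟩

lemma IsOddSimple.one_notMem_overlined {n : ℕ} {o : Overpartition n} (h : o.IsOddSimple) :
    1 ∉ o.overlined := fun h1 =>
  h.odd_not_overlined 1 (Multiset.mem_toFinset.1 (o.overlined_subset h1)) odd_one h1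

lemma IsOddSimple.one_notMem_erase {n : ℕ} {o : Overpartition n} (h : o.IsOddSimple) :
    1 ∉ o.toPartition.parts.erase 1 := by
  intro hm
  have hc := h.odd_not_repeated 1 (Multiset.mem_of_mem_erase hm) odd_one
  have := Multiset.count_pos.2 hm
  rw [Multiset.count_erase_self] at this
  omega

/-- Insert one more part `1`, without adding an overline. -/
def addOne {n : ℕ} (o : Overpartition n) : Overpartition (n + 1) where
  toPartition :=
    { parts := 1 ::ₘ o.toPartition.parts
      parts_pos := by
        intro i hi
        rcases Multiset.mem_cons.1 hi with rfl | hi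
        · exact one_pos
        · exact o.toPartition.parts_pos hi
      parts_sum := by rw [Multiset.sum_cons, o.toPartition.parts_sum, add_comm] }
  overlined := o.overlined
  overlined_subset := fun i hi => by
    have := o.overlined_subset hi
    simp_all

/-- Replace one part `1` by a part `2`. The overlines on the parts other than `1` are kept, so `2`
is overlined afterwards only if it was an overlined part before. -/
def oneToTwo {n : ℕ} (o : Overpartition n) (h : 1 ∈ o.toPartition.parts) :
    Overpartition (n + 1) where
  toPartition :=
    { parts := 2 ::ₘ o.toPartition.parts.erase 1
      parts_pos := by
        intro i hi
        rcases Multiset.mem_cons.1 hi with rfl | hi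
        · exact two_pos
        · exact o.toPartition.parts_pos (Multiset.mem_of_mem_erase hi)
      parts_sum := by
        have h1 := Multiset.sum_erase h
        rw [o.toPartition.parts_sum] at h1
        rw [Multiset.sum_cons]
        omega }
  overlined := o.overlined.erase 1
  overlined_subset := fun i hi => by
    obtain ⟨hi1, hi⟩ := Finset.mem_erase.1 hi
    have := Multiset.mem_toFinset.1 (o.overlined_subset hi)
    exact Multiset.mem_toFinset.2
      (Multiset.mem_cons_of_mem ((Multiset.mem_erase_of_ne hi1).2 this))

open Classical in
/-- The injection from overpartitions of `n` to overpartitions of `n + 1`: replace a part `1` by a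
non-overlined part `2` if there is one, and insert a part `1` otherwise. -/
noncomputable def raise {n : ℕ} (o : Overpartition n) : Overpartition (n + 1) :=
  if h : 1 ∈ o.toPartition.parts then o.oneToTwo h else o.addOne

lemma IsOddSimple.isEv_addOne {n : ℕ} {o : Overpartition n} (h : o.IsOddSimple)
    (h1 : 1 ∉ o.toPartition.parts) : o.addOne.IsEv where
  odd_not_repeated := by
    intro m hm hodd
    rcases Multiset.mem_cons.1 hm with rfl | hm
    · change Multiset.count 1 (1 ::ₘ _) = 1
      rw [Multiset.count_cons_self, Multiset.count_eq_zero_of_notMem h1]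
    · have hm1 : m ≠ 1 := fun e => h1 (e ▸ hm)
      change Multiset.count m (1 ::ₘ _) = 1
      rw [Multiset.count_cons_of_ne hm1, h.odd_not_repeated m hm hodd]
  odd_not_overlined := by
    intro m hm hodd
    rcases Multiset.mem_cons.1 hm with rfl | hm
    · exact h.one_notMem_overlined
    · exact h.odd_not_overlined m hm hodd
  smallest_not_overlined := by
    intro m hm he _
    -- The smallest part is `1`, which is odd.
    have h2 := hm.2 1 (Multiset.mem_cons_self _ _)
    have h3 := o.addOne.toPartition.parts_pos hm.1
    obtain rfl : m = 1 := by omega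
    exact absurd he (by decide)

/-- The smallest part of the result is `2`. If it occurs only once then it is the new, non-overlined
one. -/
lemma IsOddSimple.isEv_oneToTwo {n : ℕ} {o : Overpartition n} (h : o.IsOddSimple)
    (h1 : 1 ∈ o.toPartition.parts) : (o.oneToTwo h1).IsEv where
  odd_not_repeated := by
    intro m hm hodd
    rcases Multiset.mem_cons.1 hm with rfl | hm
    · exact absurd hodd (by decide)
    · have hm1 : m ≠ 1 := fun e => h.one_notMem_erase (e ▸ hm)
      have hm2 : m ≠ 2 := by rintro rfl; exact absurd hodd (by decide)
      change Multiset.count m (2 ::ₘ _) = 1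
      rw [Multiset.count_cons_of_ne hm2, Multiset.count_erase_of_ne hm1,
        h.odd_not_repeated m (Multiset.mem_of_mem_erase hm) hodd]
  odd_not_overlined := by
    intro m hm hodd
    rcases Multiset.mem_cons.1 hm with rfl | hm
    · exact absurd hodd (by decide)
    · intro hov
      exact h.odd_not_overlined m (Multiset.mem_of_mem_erase hm) hodd (Finset.mem_of_mem_erase hov)
  smallest_not_overlined := by
    intro m hm he hc hov
    have h2 := hm.2 2 (Multiset.mem_cons_self _ _)
    have h3 := (o.oneToTwo h1).toPartition.parts_pos hm.1
    obtain rfl : m = 2 := by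
      rcases he with ⟨k, rfl⟩
      omega
    change Multiset.count 2 (2 ::ₘ _) = 1 at hc
    rw [Multiset.count_cons_self, Multiset.count_erase_of_ne (by decide)] at hc
    have hmem := Multiset.mem_toFinset.1 (o.overlined_subset (Finset.mem_of_mem_erase hov))
    have := Multiset.count_pos.2 hmem
    omega

lemma IsOddSimple.isEv_raise {n : ℕ} {o : Overpartition n} (h : o.IsOddSimple) :
    o.raise.IsEv := by
  unfold raise
  split_ifs with h1
  · exact h.isEv_oneToTwo h1
  · exact h.isEv_addOne h1

/-- The presence of a part `1` in the image tells which of the two cases of `raise` applies. -/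
lemma IsOddSimple.one_mem_raise {n : ℕ} {o : Overpartition n} (h : o.IsOddSimple) :
    1 ∈ o.raise.toPartition.parts ↔ 1 ∉ o.toPartition.parts := by
  unfold raise
  split_ifs with h1
  · refine iff_of_false (fun hm => ?_) (not_not.2 h1)
    rcases Multiset.mem_cons.1 hm with hm | hm
    · exact absurd hm (by decide)
    · exact h.one_notMem_erase hm
  · exact iff_of_true (Multiset.mem_cons_self _ _) h1

lemma raise_injOn (n : ℕ) : Set.InjOn raise {o : Overpartition n | o.IsOddSimple} := by
  intro o ho o' ho' heq
  have hiff : 1 ∈ o.toPartition.parts ↔ 1 ∈ o'.toPartition.parts := by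
    rw [← not_iff_not, ← ho.one_mem_raise, ← ho'.one_mem_raise, heq]
  by_cases h1 : 1 ∈ o.toPartition.parts
  · have h1' := hiff.1 h1
    rw [raise, raise, dif_pos h1, dif_pos h1'] at heq
    have hp : 2 ::ₘ o.toPartition.parts.erase 1 = 2 ::ₘ o'.toPartition.parts.erase 1 :=
      congrArg (fun x => x.toPartition.parts) heq
    have hov : o.overlined.erase 1 = o'.overlined.erase 1 := congrArg (fun x => x.overlined) heq
    rw [Finset.erase_eq_of_notMem ho.one_notMem_overlined,
      Finset.erase_eq_of_notMem ho'.one_notMem_overlined] at hov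
    refine Overpartition.ext (Nat.Partition.ext ?_) hov
    rw [← Multiset.cons_erase h1, ← Multiset.cons_erase h1', (Multiset.cons_inj_right 2).1 hp]
  · have h1' := fun h => h1 (hiff.2 h)
    rw [raise, raise, dif_neg h1, dif_neg h1'] at heq
    have hp : 1 ::ₘ o.toPartition.parts = 1 ::ₘ o'.toPartition.parts :=
      congrArg (fun x => x.toPartition.parts) heq
    have hov : o.overlined = o'.overlined := congrArg (fun x => x.overlined) heq
    exact Overpartition.ext (Nat.Partition.ext ((Multiset.cons_inj_right 1).1 hp)) hov

end Overpartition

/-- The number of overpartitions of `n` whose odd parts are neither repeated nor overlined. -/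
noncomputable def cardOddSimple (n : ℕ) : ℕ := Nat.card {o : Overpartition n // o.IsOddSimple}

lemma pEv_le_cardOddSimple (n : ℕ) : pEv n ≤ cardOddSimple n :=
  Nat.card_le_card_of_injective (fun o => ⟨o.1, o.2.isOddSimple⟩) fun _ _ h =>
    Subtype.ext (congrArg (fun x => x.1) h)

lemma cardOddSimple_le_pEv_succ (n : ℕ) : cardOddSimple n ≤ pEv (n + 1) :=
  Nat.card_le_card_of_injective (fun o => ⟨o.1.raise, o.2.isEv_raise⟩) fun o o' h =>
    Subtype.ext (Overpartition.raise_injOn n o.2 o'.2 (congrArg (fun x => x.1) h))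

/-- The number of ways in which a part `i` occurring `c ≥ 1` times can be overlined in an
overpartition whose odd parts are neither repeated nor overlined. -/
def oddSimpleWeight (R : Type*) [Semiring R] (i c : ℕ) : R :=
  if Odd i then (if c = 1 then 1 else 0) else 2

lemma cardOddSimple_eq_sum (n : ℕ) : cardOddSimple n =
    ∑ p : n.Partition, p.parts.toFinsupp.prod (oddSimpleWeight ℕ) := by
  classical
  let e : {o : Overpartition n // o.IsOddSimple} ≃ Σ p : n.Partition,
      {s : Finset ℕ // s ⊆ p.parts.toFinset ∧ (∀ m ∈ p.parts, Odd m → p.parts.count m = 1) ∧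
        ∀ m ∈ p.parts, Odd m → m ∉ s} :=
    { toFun := fun o => ⟨o.1.toPartition, o.1.overlined, o.1.overlined_subset, o.2.1, o.2.2⟩
      invFun := fun x => ⟨⟨x.1, x.2.1, x.2.2.1⟩, x.2.2.2.1, x.2.2.2.2⟩
      left_inv := fun _ => rfl
      right_inv := fun _ => rfl }
  have hfin (p : n.Partition) : Finite {s : Finset ℕ // s ⊆ p.parts.toFinset ∧
      (∀ m ∈ p.parts, Odd m → p.parts.count m = 1) ∧ ∀ m ∈ p.parts, Odd m → m ∉ s} :=
    Set.Finite.subset (s := (p.parts.toFinset.powerset : Set (Finset ℕ)))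
      (Finset.finite_toSet _) fun s hs => by simpa using hs.1
  rw [cardOddSimple, Nat.card_congr e, Nat.card_sigma]
  refine Finset.sum_congr rfl fun p _ => ?_
  rw [Finsupp.prod, Multiset.toFinsupp_support]
  simp only [Multiset.toFinsupp_apply, oddSimpleWeight]
  by_cases hp : ∀ m ∈ p.parts, Odd m → p.parts.count m = 1
  · have hset : ∀ s : Finset ℕ, (s ⊆ p.parts.toFinset ∧
        (∀ m ∈ p.parts, Odd m → p.parts.count m = 1) ∧ ∀ m ∈ p.parts, Odd m → m ∉ s) ↔
        s ∈ (p.parts.toFinset.filter (fun m => ¬ Odd m)).powerset := by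
      intro s
      rw [Finset.mem_powerset]
      constructor
      · rintro ⟨h1, -, h2⟩ m hm
        have := h1 hm
        exact Finset.mem_filter.2 ⟨this, fun ho => h2 m (Multiset.mem_toFinset.1 this) ho hm⟩
      · intro h
        exact ⟨h.trans (Finset.filter_subset _ _), hp, fun m _ ho hm =>
          (Finset.mem_filter.1 (h hm)).2 ho⟩
    rw [Nat.card_congr (Equiv.subtypeEquivRight hset), Nat.card_eq_fintype_card,
      Fintype.card_coe, Finset.card_powerset, ← Finset.prod_const, Finset.prod_filter]
    refine Finset.prod_congr rfl fun m hm => ?_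
    by_cases ho : Odd m
    · simp [ho, hp m (Multiset.mem_toFinset.1 hm) ho]
    · simp [ho]
  · have : IsEmpty {s : Finset ℕ // s ⊆ p.parts.toFinset ∧
        (∀ m ∈ p.parts, Odd m → p.parts.count m = 1) ∧ ∀ m ∈ p.parts, Odd m → m ∉ s} :=
      ⟨fun s => hp s.2.2.1⟩
    rw [Nat.card_of_isEmpty]
    push Not at hp
    obtain ⟨m, hm, ho, hc⟩ := hp
    exact (Finset.prod_eq_zero (Multiset.mem_toFinset.2 hm) (by simp [ho, hc])).symm

open PowerSeries in
lemma coeff_genFun_oddSimpleWeight (n : ℕ) :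
    (Nat.Partition.genFun (oddSimpleWeight ℂ)).coeff n = (cardOddSimple n : ℂ) := by
  rw [Nat.Partition.coeff_genFun, cardOddSimple_eq_sum, Nat.cast_sum]
  refine Finset.sum_congr rfl fun p _ => ?_
  rw [Finsupp.prod, Finsupp.prod, Nat.cast_prod]
  refine Finset.prod_congr rfl fun m _ => ?_
  unfold oddSimpleWeight
  split_ifs <;> simp

/-! ### The generating function and the coefficient formula -/

section GeneratingFunction

open Topology PowerSeries PowerSeries.WithPiTopology

/-- The formal power series `f` converges absolutely to `F` on the open unit disc. -/
def HasPowerSeriesOnUnitDisc (f : ℂ⟦X⟧) (F : ℂ → ℂ) : Prop :=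
  ∀ z : ℂ, ‖z‖ < 1 → Summable (fun n => ‖f.coeff n * z ^ n‖) ∧ ∑' n, f.coeff n * z ^ n = F z

namespace HasPowerSeriesOnUnitDisc

lemma one : HasPowerSeriesOnUnitDisc 1 (fun _ => 1) := by
  intro z _
  have h : ∀ n, n ≠ 0 → (1 : ℂ⟦X⟧).coeff n * z ^ n = 0 := fun n hn => by
    simp [PowerSeries.coeff_one, hn]
  refine ⟨summable_of_ne_finset_zero (s := {0}) fun n hn => ?_, ?_⟩
  · rw [h n (by simpa using hn), norm_zero]
  · rw [tsum_eq_single 0 h]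
    simp

lemma mul {f g : ℂ⟦X⟧} {F G : ℂ → ℂ} (hf : HasPowerSeriesOnUnitDisc f F)
    (hg : HasPowerSeriesOnUnitDisc g G) :
    HasPowerSeriesOnUnitDisc (f * g) (fun z => F z * G z) := by
  intro z hz
  obtain ⟨hf1, hf2⟩ := hf z hz
  obtain ⟨hg1, hg2⟩ := hg z hz
  have key : (fun n => (f * g).coeff n * z ^ n) = fun n =>
      ∑ kl ∈ Finset.HasAntidiagonal.antidiagonal n,
        (f.coeff kl.1 * z ^ kl.1) * (g.coeff kl.2 * z ^ kl.2) := by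
    funext n
    rw [PowerSeries.coeff_mul, Finset.sum_mul]
    refine Finset.sum_congr rfl fun kl hkl => ?_
    have hkl' : kl.1 + kl.2 = n := Finset.HasAntidiagonal.mem_antidiagonal.1 hkl
    rw [← hkl', pow_add]
    ring
  constructor
  · exact (summable_norm_sum_mul_antidiagonal_of_summable_norm hf1 hg1).congr fun n =>
      congrArg norm (congrFun key n).symm
  · rw [key, ← tsum_mul_tsum_eq_tsum_sum_antidiagonal_of_summable_norm hf1 hg1, hf2, hg2]

lemma prod {ι : Type*} (s : Finset ι) {f : ι → ℂ⟦X⟧} {F : ι → ℂ → ℂ}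
    (h : ∀ i ∈ s, HasPowerSeriesOnUnitDisc (f i) (F i)) :
    HasPowerSeriesOnUnitDisc (∏ i ∈ s, f i) (fun z => ∏ i ∈ s, F i z) := by
  classical
  induction s using Finset.induction_on with
  | empty => simpa using one
  | insert a s ha ih =>
    simp only [Finset.prod_insert ha]
    exact (h a (Finset.mem_insert_self _ _)).mul
      (ih fun i hi => h i (Finset.mem_insert_of_mem hi))

/-- Cauchy's coefficient formula on the circle of radius `exp (-t)`. -/
lemma integral_eq {f : ℂ⟦X⟧} {F : ℂ → ℂ} (h : HasPowerSeriesOnUnitDisc f F) {t : ℝ} (ht : 0 < t)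
    (n : ℕ) :
    ∫ θ in (-Real.pi)..Real.pi, F (Complex.exp (-(t + θ * Complex.I))) *
      Complex.exp (n * (t + θ * Complex.I)) = 2 * Real.pi * f.coeff n := by
  have hn (θ : ℝ) : ‖Complex.exp (-(t + θ * Complex.I))‖ = Real.exp (-t) := by
    simp [Complex.norm_exp]
  have hlt (θ : ℝ) : ‖Complex.exp (-(t + θ * Complex.I))‖ < 1 := by
    rw [hn]; simpa using ht
  have hn' (θ : ℝ) : ‖Complex.exp (n * (t + θ * Complex.I))‖ = Real.exp (n * t) := by
    simp [Complex.norm_exp]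
  have hs := (h _ (hlt 0)).1
  have key := intervalIntegral.hasSum_integral_of_dominated_convergence
    (μ := MeasureTheory.volume) (a := -Real.pi) (b := Real.pi)
    (F := fun (k : ℕ) (θ : ℝ) => f.coeff k * Complex.exp (-(t + θ * Complex.I)) ^ k *
      Complex.exp (n * (t + θ * Complex.I)))
    (f := fun θ : ℝ => F (Complex.exp (-(t + θ * Complex.I))) *
      Complex.exp (n * (t + θ * Complex.I)))
    (fun k _ => ‖f.coeff k * Complex.exp (-(t + (0 : ℝ) * Complex.I)) ^ k‖ * Real.exp (n * t))
    (fun k => Continuous.aestronglyMeasurable (by fun_prop))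
    (fun k => Eventually.of_forall fun θ _ => by
      simp only [norm_mul, norm_pow, hn, hn', le_refl])
    (Eventually.of_forall fun θ _ => hs.mul_right _)
    intervalIntegrable_const
    (Eventually.of_forall fun θ _ => by
      have := h _ (hlt θ)
      rw [← this.2]
      exact this.1.of_norm.hasSum.mul_right _)
  have hterm (k : ℕ) : ∫ θ in (-Real.pi)..Real.pi, f.coeff k *
      Complex.exp (-(t + θ * Complex.I)) ^ k * Complex.exp (n * (t + θ * Complex.I)) =
      if k = n then 2 * Real.pi * f.coeff n else 0 := by
    have e (θ : ℝ) : f.coeff k * Complex.exp (-(t + θ * Complex.I)) ^ k *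
        Complex.exp (n * (t + θ * Complex.I)) = f.coeff k * Complex.exp (((n : ℂ) - k) * t) *
        Complex.exp ((((n : ℂ) - k) * Complex.I) * θ) := by
      rw [← Complex.exp_nat_mul, mul_assoc, mul_assoc, ← Complex.exp_add, ← Complex.exp_add]
      ring_nf
    simp only [e]
    rw [intervalIntegral.integral_const_mul]
    split_ifs with hk
    · subst hk
      simp
      ring
    · have hne : ((n : ℂ) - k) * Complex.I ≠ 0 :=
        mul_ne_zero (sub_ne_zero.2 (Nat.cast_injective.ne (Ne.symm hk))) Complex.I_ne_zero
      rw [integral_exp_mul_complex hne]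
      -- The frequency `n - k` is a nonzero integer, so the exponential has equal values at `±π`.
      have hper : Complex.exp ((((n : ℂ) - k) * Complex.I) * (Real.pi : ℝ)) =
          Complex.exp ((((n : ℂ) - k) * Complex.I) * ((-Real.pi : ℝ) : ℂ)) := by
        rw [Complex.exp_eq_exp_iff_exists_int]
        refine ⟨(n : ℤ) - k, ?_⟩
        push_cast
        ring
      rw [hper]
      simp
  simp only [hterm] at key
  exact key.unique (by simpa using hasSum_ite_eq n (2 * Real.pi * f.coeff n))

end HasPowerSeriesOnUnitDisc

/-- The factor of the generating function of `cardOddSimple` that belongs to the part `i + 1`. -/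
noncomputable def oddSimpleFactor (i : ℕ) (z : ℂ) : ℂ :=
  if Odd (i + 1) then 1 + z ^ (i + 1) else (1 + z ^ (i + 1)) / (1 - z ^ (i + 1))

lemma hasPowerSeriesOnUnitDisc_one_add_X_pow {k : ℕ} (hk : k ≠ 0) :
    HasPowerSeriesOnUnitDisc (1 + X ^ k) (fun z => 1 + z ^ k) := by
  intro z _
  have h : ∀ n, n ∉ ({0, k} : Finset ℕ) → (1 + X ^ k : ℂ⟦X⟧).coeff n * z ^ n = 0 := fun n hn => by
    simp only [Finset.mem_insert, Finset.mem_singleton, not_or] at hn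
    simp [PowerSeries.coeff_one, PowerSeries.coeff_X_pow, hn.1, hn.2]
  refine ⟨summable_of_ne_finset_zero (s := {0, k}) fun n hn => ?_, ?_⟩
  · rw [h n hn, norm_zero]
  · rw [tsum_eq_sum h, Finset.sum_pair hk.symm]
    simp [PowerSeries.coeff_one, PowerSeries.coeff_X_pow, hk]

lemma one_sub_pow_ne_zero {z : ℂ} (hz : ‖z‖ < 1) {k : ℕ} (hk : k ≠ 0) : 1 - z ^ k ≠ 0 := by
  intro h
  have h1 : ‖z ^ k‖ = 1 := by rw [← sub_eq_zero.1 h, norm_one]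
  rw [norm_pow] at h1
  exact (pow_lt_one₀ (norm_nonneg _) hz hk).ne h1

lemma hasPowerSeriesOnUnitDisc_one_add_pow_div {k : ℕ} (hk : k ≠ 0) {f : ℂ⟦X⟧}
    (hf : ∀ n, f.coeff n = if n = 0 then 1 else if k ∣ n then 2 else 0) :
    HasPowerSeriesOnUnitDisc f (fun z => (1 + z ^ k) / (1 - z ^ k)) := by
  intro z hz
  constructor
  · refine Summable.of_nonneg_of_le (fun _ => norm_nonneg _) (fun n => ?_)
      ((summable_geometric_of_lt_one (norm_nonneg z) hz).mul_left 2)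
    rw [norm_mul, norm_pow, hf]
    gcongr
    split_ifs <;> norm_num
  · have h1 : HasSum (fun n => if k ∣ n then z ^ n else 0) (1 - z ^ k)⁻¹ := by
      have hinj : Function.Injective (fun j : ℕ => k * j) := fun a b h =>
        Nat.eq_of_mul_eq_mul_left (Nat.pos_of_ne_zero hk) h
      rw [← hinj.hasSum_iff]
      · have hzk : ‖z ^ k‖ < 1 := by
          rw [norm_pow]; exact pow_lt_one₀ (norm_nonneg _) hz hk
        simpa [Function.comp_def, pow_mul] using hasSum_geometric_of_norm_lt_one hzk
      · intro n hn
        rw [if_neg]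
        rintro ⟨j, rfl⟩
        exact hn ⟨j, rfl⟩
    have h2 := (h1.mul_left 2).sub (hasSum_ite_eq 0 (1 : ℂ))
    have h3 : ∀ n, f.coeff n * z ^ n =
        2 * (if k ∣ n then z ^ n else 0) - if n = 0 then 1 else 0 := by
      intro n
      rw [hf]
      by_cases hn : n = 0
      · subst hn; norm_num
      · by_cases hd : k ∣ n <;> simp [hn, hd]
    simp only [h3]
    rw [h2.tsum_eq]
    have := one_sub_pow_ne_zero hz hk
    field_simp
    ring

lemma hasPowerSeriesOnUnitDisc_oddSimpleFactor (i : ℕ) :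
    HasPowerSeriesOnUnitDisc
      (1 + ∑' j, oddSimpleWeight ℂ (i + 1) (j + 1) • (X : ℂ⟦X⟧) ^ ((i + 1) * (j + 1)))
      (oddSimpleFactor i) := by
  unfold oddSimpleFactor oddSimpleWeight
  by_cases ho : Odd (i + 1)
  · simp only [ho, if_true]
    rw [tsum_eq_single 0 (fun j hj => by simp [hj])]
    simpa using hasPowerSeriesOnUnitDisc_one_add_X_pow (Nat.succ_ne_zero i)
  · simp only [ho, if_false]
    refine hasPowerSeriesOnUnitDisc_one_add_pow_div (Nat.succ_ne_zero i) fun n => ?_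
    have hs := Nat.Partition.summable_genFun_term (fun _ _ => (2 : ℂ)) i
    rw [map_add, hs.map_tsum _ (continuous_coeff ℂ n)]
    simp only [PowerSeries.coeff_one, map_smul, PowerSeries.coeff_X_pow, smul_eq_mul, mul_ite,
      mul_one, mul_zero]
    by_cases hn : n = 0
    · subst hn
      simp
    · rw [if_neg hn, if_neg hn, zero_add]
      split_ifs with hd
      · obtain ⟨j, rfl⟩ := hd
        obtain ⟨j, rfl⟩ := Nat.exists_eq_succ_of_ne_zero (right_ne_zero_of_mul hn)
        rw [tsum_eq_single j]
        · simp
        · intro b hb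
          rw [if_neg]
          intro h
          have := Nat.eq_of_mul_eq_mul_left (Nat.succ_pos i) h
          omega
      · exact (tsum_congr fun j => if_neg fun h => hd ⟨j + 1, h⟩).trans tsum_zero

/-- Euler's product `∏ (1 - z ^ k)` over `k ≥ 1`, for `‖z‖ < 1`. -/
noncomputable def eulerProd (z : ℂ) : ℂ := ∏' n : ℕ, (1 - z ^ (n + 1))

lemma tendsto_prod_eulerProd {z : ℂ} (hz : ‖z‖ < 1) :
    Tendsto (fun N => ∏ i ∈ Finset.range N, (1 - z ^ (i + 1))) atTop (𝓝 (eulerProd z)) :=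
  (ModularForm.multipliable_one_sub_pow hz).hasProd.tendsto_prod_nat

lemma eulerProd_ne_zero {z : ℂ} (hz : ‖z‖ < 1) : eulerProd z ≠ 0 := by
  refine tprod_one_add_ne_zero_of_summable (f := fun n : ℕ => -z ^ (n + 1)) (fun i => ?_) ?_
  · simpa [← sub_eq_add_neg] using one_sub_pow_ne_zero hz (Nat.succ_ne_zero i)
  · simpa using (summable_nat_add_iff 1).mpr (summable_geometric_of_lt_one (norm_nonneg _) hz)

lemma continuousOn_eulerProd : ContinuousOn eulerProd (Metric.ball 0 1) :=
  ModularForm.differentiableOn_tprod_one_sub_pow.continuousOn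

/-- The finite form of Euler's identity `∏ (1 + q ^ k) = ∏ 1 / (1 - q ^ (2 k - 1))`, arranged so that
the two products in `z ^ 2` have the same limit. -/
lemma prod_oddSimpleFactor_mul {z : ℂ} (hz : ‖z‖ < 1) (M : ℕ) :
    (∏ i ∈ Finset.range (2 * M), oddSimpleFactor i z) *
      (∏ i ∈ Finset.range (2 * M), (1 - z ^ (i + 1))) *
      (∏ i ∈ Finset.range M, (1 - (z ^ 2) ^ (i + 1))) =
      ∏ i ∈ Finset.range (2 * M), (1 - (z ^ 2) ^ (i + 1)) := by
  induction M with
  | zero => simp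
  | succ M ih =>
    rw [show 2 * (M + 1) = 2 * M + 1 + 1 by ring]
    simp only [Finset.prod_range_succ, ← ih]
    have ho : Odd (2 * M + 1) := ⟨M, rfl⟩
    have he : ¬ Odd (2 * M + 1 + 1) := by
      rw [Nat.not_odd_iff_even]; exact ⟨M + 1, by ring⟩
    have hne := one_sub_pow_ne_zero hz (Nat.succ_ne_zero (2 * M + 1))
    rw [Nat.succ_eq_add_one] at hne
    simp only [oddSimpleFactor, ho, he, if_true, if_false]
    field_simp
    ring

/-- The generating function of `cardOddSimple` is that of the partition function. -/
lemma tendsto_prod_oddSimpleFactor {z : ℂ} (hz : ‖z‖ < 1) :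
    Tendsto (fun M => ∏ i ∈ Finset.range (2 * M), oddSimpleFactor i z) atTop
      (𝓝 (eulerProd z)⁻¹) := by
  have hz2 : ‖z ^ 2‖ < 1 := by
    rw [norm_pow]; exact pow_lt_one₀ (norm_nonneg _) hz two_ne_zero
  have h2 : Tendsto (fun M : ℕ => 2 * M) atTop atTop := tendsto_id.const_mul_atTop' two_pos
  have hlim := ((tendsto_prod_eulerProd hz2).comp h2).div
    (((tendsto_prod_eulerProd hz).comp h2).mul (tendsto_prod_eulerProd hz2))
    (mul_ne_zero (eulerProd_ne_zero hz) (eulerProd_ne_zero hz2))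
  have hval : eulerProd (z ^ 2) / (eulerProd z * eulerProd (z ^ 2)) = (eulerProd z)⁻¹ := by
    have := eulerProd_ne_zero hz
    have := eulerProd_ne_zero hz2
    field_simp
  rw [hval] at hlim
  refine hlim.congr fun M => ?_
  have hne : ∀ (w : ℂ), ‖w‖ < 1 → ∀ N, ∏ i ∈ Finset.range N, (1 - w ^ (i + 1)) ≠ 0 :=
    fun w hw N => Finset.prod_ne_zero_iff.2 fun i _ => one_sub_pow_ne_zero hw (Nat.succ_ne_zero i)
  simp only [Function.comp_apply, Pi.div_apply]
  rw [← prod_oddSimpleFactor_mul hz M, div_eq_iff (mul_ne_zero (hne z hz _) (hne _ hz2 _)),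
    mul_assoc]

lemma norm_oddSimpleFactor_le (i : ℕ) {z : ℂ} (hz : ‖z‖ < 1) :
    ‖oddSimpleFactor i z‖ ≤ ‖oddSimpleFactor i (‖z‖ : ℂ)‖ := by
  have hr := norm_nonneg z
  have h1 : ‖1 + z ^ (i + 1)‖ ≤ 1 + ‖z‖ ^ (i + 1) := by
    simpa using norm_add_le 1 (z ^ (i + 1))
  have h2 : 1 - ‖z‖ ^ (i + 1) ≤ ‖1 - z ^ (i + 1)‖ := by
    simpa using norm_sub_norm_le 1 (z ^ (i + 1))
  have h3 : 0 < 1 - ‖z‖ ^ (i + 1) := sub_pos.2 (pow_lt_one₀ hr hz (Nat.succ_ne_zero i))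
  have e1 : ‖(1 : ℂ) + (‖z‖ : ℂ) ^ (i + 1)‖ = 1 + ‖z‖ ^ (i + 1) := by
    rw [← Complex.ofReal_pow, ← Complex.ofReal_one, ← Complex.ofReal_add, Complex.norm_real,
      Real.norm_of_nonneg (by positivity)]
  have e2 : ‖(1 : ℂ) - (‖z‖ : ℂ) ^ (i + 1)‖ = 1 - ‖z‖ ^ (i + 1) := by
    rw [← Complex.ofReal_pow, ← Complex.ofReal_one, ← Complex.ofReal_sub, Complex.norm_real,
      Real.norm_of_nonneg h3.le]
  unfold oddSimpleFactor
  split_ifs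
  · rwa [e1]
  · rw [norm_div, norm_div, e1, e2]
    gcongr

lemma continuousOn_oddSimpleFactor (i : ℕ) :
    ContinuousOn (oddSimpleFactor i) (Metric.ball 0 1) := by
  unfold oddSimpleFactor
  split_ifs
  · fun_prop
  · exact ContinuousOn.div (by fun_prop) (by fun_prop) fun z hz =>
      one_sub_pow_ne_zero (by simpa using hz) (Nat.succ_ne_zero i)

lemma norm_exp_neg_ofReal_add_mul_I (t θ : ℝ) :
    ‖Complex.exp (-(t + θ * Complex.I))‖ = Real.exp (-t) := by
  simp [Complex.norm_exp]

lemma norm_exp_neg_lt_one {t : ℝ} (ht : 0 < t) (θ : ℝ) :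
    ‖Complex.exp (-(t + θ * Complex.I))‖ < 1 := by
  rw [norm_exp_neg_ofReal_add_mul_I]; simpa using ht

/-- The coefficient formula for the infinite product. It is obtained from the finite products, which
are dominated on the circle by their values at the positive point. -/
lemma integral_eulerProd_inv_mul_exp {t : ℝ} (ht : 0 < t) (n : ℕ) :
    ∫ θ in (-Real.pi)..Real.pi, (eulerProd (Complex.exp (-(t + θ * Complex.I))))⁻¹ *
      Complex.exp (n * (t + θ * Complex.I)) = 2 * Real.pi * cardOddSimple n := by
  have hint (M : ℕ) := (HasPowerSeriesOnUnitDisc.prod (Finset.range (2 * M)) fun i _ =>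
    hasPowerSeriesOnUnitDisc_oddSimpleFactor i).integral_eq ht n
  have h2 : Tendsto (fun M : ℕ => 2 * M) atTop atTop := tendsto_id.const_mul_atTop' two_pos
  have hcoeff : Tendsto (fun M : ℕ => (∏ i ∈ Finset.range (2 * M), (1 + ∑' j,
      oddSimpleWeight ℂ (i + 1) (j + 1) • (X : ℂ⟦X⟧) ^ ((i + 1) * (j + 1)))).coeff n) atTop
      (𝓝 (cardOddSimple n : ℂ)) := by
    rw [← coeff_genFun_oddSimpleWeight]
    exact ((continuous_coeff ℂ n).tendsto _).comp
      ((Nat.Partition.hasProd_genFun (oddSimpleWeight ℂ)).tendsto_prod_nat.comp h2)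
  have hr : ‖((Real.exp (-t) : ℝ) : ℂ)‖ < 1 := by
    rw [Complex.norm_real, Real.norm_of_nonneg (Real.exp_pos _).le]
    simpa using ht
  obtain ⟨B, hB⟩ := (tendsto_prod_oddSimpleFactor hr).norm.bddAbove_range
  refine tendsto_nhds_unique ?_ ((hcoeff.const_mul (2 * Real.pi : ℂ)).congr fun M => (hint M).symm)
  refine intervalIntegral.tendsto_integral_filter_of_dominated_convergence
    (fun _ => B * Real.exp (n * t)) (Eventually.of_forall fun M => ?_)
    (Eventually.of_forall fun M => Eventually.of_forall fun θ _ => ?_)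
    intervalIntegrable_const (Eventually.of_forall fun θ _ => ?_)
  · refine Continuous.aestronglyMeasurable (Continuous.mul ?_ (by fun_prop))
    refine continuous_finsetProd _ fun i _ => ?_
    exact (continuousOn_oddSimpleFactor i).comp_continuous (by fun_prop) fun θ => by
      simpa using norm_exp_neg_lt_one ht θ
  · rw [norm_mul]
    have e : ‖Complex.exp (n * (t + θ * Complex.I))‖ = Real.exp (n * t) := by
      simp [Complex.norm_exp]
    rw [e]
    gcongr
    refine le_trans ?_ (hB ⟨M, rfl⟩)
    simp only [norm_prod]
    refine Finset.prod_le_prod (fun _ _ => norm_nonneg _) fun i _ => ?_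
    have := norm_oddSimpleFactor_le i (norm_exp_neg_lt_one ht θ)
    rwa [norm_exp_neg_ofReal_add_mul_I] at this
  · exact (tendsto_prod_oddSimpleFactor (norm_exp_neg_lt_one ht θ)).mul_const _

end GeneratingFunction

open Topology

/-! ### The size of Euler's product away from the positive axis -/

lemma norm_sum_pow_succ_le {z : ℂ} (hz : ‖z‖ < 1) (N : ℕ) :
    ‖∑ i ∈ Finset.range N, z ^ (i + 1)‖ ≤ (1 + ‖z‖ ^ N) / ‖1 - z‖ := by
  have h1 : 1 - z ≠ 0 := by simpa using one_sub_pow_ne_zero hz one_ne_zero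
  rw [le_div_iff₀ (norm_pos_iff.2 h1), ← norm_mul, Finset.sum_congr rfl fun i _ => pow_succ z i,
    ← Finset.sum_mul, mul_right_comm, geom_sum_mul_neg, norm_mul, norm_sub_rev]
  calc ‖z ^ N - 1‖ * ‖z‖ ≤ (‖z‖ ^ N + 1) * 1 := by
        gcongr
        simpa using norm_sub_le (z ^ N) 1
    _ = 1 + ‖z‖ ^ N := by ring

lemma norm_sum_exp_pow_le {t : ℝ} (ht : 0 < t) {z : ℂ} (hz : ‖z‖ = Real.exp (-t)) {m : ℕ}
    (hm : m ≠ 0) (N : ℕ) :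
    ‖∑ i ∈ Finset.range N, (z ^ (i + 1)) ^ m‖ ≤ 1 / (m * t) := by
  have hmt : 0 < m * t := by positivity
  have hlt : Real.exp (-(m * t)) < 1 := by simpa using hmt
  calc ‖∑ i ∈ Finset.range N, (z ^ (i + 1)) ^ m‖
      ≤ ∑ i ∈ Finset.range N, Real.exp (-(m * t)) * Real.exp (-(m * t)) ^ i := by
        refine norm_sum_le_of_le _ fun i _ => le_of_eq ?_
        rw [norm_pow, norm_pow, hz, ← pow_mul, ← pow_succ', ← Real.exp_nat_mul, ← Real.exp_nat_mul]
        congr 1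
        push_cast
        ring
    _ = Real.exp (-(m * t)) * ∑ i ∈ Finset.range N, Real.exp (-(m * t)) ^ i := by
        rw [Finset.mul_sum]
    _ ≤ Real.exp (-(m * t)) * (1 - Real.exp (-(m * t)))⁻¹ := by
        gcongr
        rw [← one_div, le_div_iff₀ (sub_pos.2 hlt), geom_sum_mul_neg]
        exact sub_le_self _ (pow_nonneg (Real.exp_pos _).le _)
    _ ≤ 1 / (m * t) := by
        rw [← div_eq_mul_inv, div_le_div_iff₀ (sub_pos.2 hlt) hmt]
        have h := Real.add_one_le_exp (m * t)
        have h2 : Real.exp (-(m * t)) * Real.exp (m * t) = 1 := by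
          rw [← Real.exp_add]; simp
        nlinarith [Real.exp_pos (-(m * t))]

/-- The finite version of `norm_eulerProd_inv_le`, where no double series occurs. -/
lemma norm_prod_inv_le {t : ℝ} (ht : 0 < t) {z : ℂ} (hz : ‖z‖ = Real.exp (-t)) (N : ℕ) :
    ‖(∏ i ∈ Finset.range N, (1 - z ^ (i + 1)))⁻¹‖ ≤
      Real.exp ((1 + ‖z‖ ^ N) / ‖1 - z‖ + (Real.pi ^ 2 / 6 - 1) / t) := by
  have hz1 : ‖z‖ < 1 := by rw [hz]; simpa using ht
  have hexp : (∏ i ∈ Finset.range N, (1 - z ^ (i + 1)))⁻¹ =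
      Complex.exp (∑ i ∈ Finset.range N, -Complex.log (1 - z ^ (i + 1))) := by
    rw [Complex.exp_sum, ← Finset.prod_inv_distrib]
    refine Finset.prod_congr rfl fun i _ => ?_
    rw [Complex.exp_neg, Complex.exp_log (one_sub_pow_ne_zero hz1 (Nat.succ_ne_zero i))]
  have hsum : HasSum (fun m : ℕ => ∑ i ∈ Finset.range N, (z ^ (i + 1)) ^ m / m)
      (∑ i ∈ Finset.range N, -Complex.log (1 - z ^ (i + 1))) :=
    hasSum_sum fun i _ => Complex.hasSum_taylorSeries_neg_log (by
      rw [norm_pow]; exact pow_lt_one₀ (norm_nonneg _) hz1 (Nat.succ_ne_zero i))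
  -- The bound `1 / (m² t)` for every `m`, corrected at `m = 1`. At `m = 0` both sides
  -- are quotients by zero, hence `0`.
  have hbound := (hasSum_zeta_two.mul_right (1 / t)).add
    (hasSum_ite_eq 1 ((1 + ‖z‖ ^ N) / ‖1 - z‖ - 1 / t))
  have hle := hsum.norm_le_of_bounded hbound fun m => by
    rw [← Finset.sum_div, norm_div, Complex.norm_natCast]
    rcases eq_or_ne m 0 with rfl | hm0
    · simp
    rcases eq_or_ne m 1 with rfl | hm1
    · simpa using norm_sum_pow_succ_le hz1 N
    · have := norm_sum_exp_pow_le ht hz hm0 N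
      have hm : (0 : ℝ) < m := by positivity
      rw [if_neg hm1, add_zero]
      calc _ ≤ 1 / (m * t) / m := by gcongr
        _ = _ := by field_simp
  rw [hexp, Complex.norm_exp]
  refine Real.exp_le_exp.2 ((Complex.re_le_norm _).trans (hle.trans (le_of_eq ?_)))
  ring

/-- In the expansion `-log (eulerProd z) = ∑ m, ∑ k, z ^ (k m) / m`, the term `m = 1` is a geometric
series in `z` and is estimated by `1 / ‖1 - z‖`; the terms `m ≥ 2` are estimated by their absolute
values, which add up to at most `(π² / 6 - 1) / t`. -/
lemma norm_eulerProd_inv_le {t : ℝ} (ht : 0 < t) {z : ℂ} (hz : ‖z‖ = Real.exp (-t)) :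
    ‖(eulerProd z)⁻¹‖ ≤ Real.exp (1 / ‖1 - z‖ + (Real.pi ^ 2 / 6 - 1) / t) := by
  have hz1 : ‖z‖ < 1 := by rw [hz]; simpa using ht
  have h1 := ((tendsto_prod_eulerProd hz1).inv₀ (eulerProd_ne_zero hz1)).norm
  have h2 : Tendsto (fun N : ℕ => Real.exp ((1 + ‖z‖ ^ N) / ‖1 - z‖ + (Real.pi ^ 2 / 6 - 1) / t))
      atTop (𝓝 (Real.exp ((1 + 0) / ‖1 - z‖ + (Real.pi ^ 2 / 6 - 1) / t))) :=
    (Real.continuous_exp.tendsto _).comp ((((tendsto_pow_atTop_nhds_zero_of_lt_one (norm_nonneg z)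
      hz1).const_add 1).div_const _).add_const _)
  rw [add_zero] at h2
  exact le_of_tendsto_of_tendsto' h1 h2 fun N => norm_prod_inv_le ht hz N

lemma norm_one_sub_exp_sq_ge {t θ : ℝ} (hθ : |θ| ≤ Real.pi) :
    4 / Real.pi ^ 2 * Real.exp (-t) * θ ^ 2 ≤ ‖1 - Complex.exp (-(t + θ * Complex.I))‖ ^ 2 := by
  have hcos := Real.cos_le_one_sub_mul_cos_sq hθ
  have hre : (Complex.exp (-(t + θ * Complex.I))).re = Real.exp (-t) * Real.cos θ := by
    simp [Complex.exp_re]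
  have him : (Complex.exp (-(t + θ * Complex.I))).im = -(Real.exp (-t) * Real.sin θ) := by
    simp [Complex.exp_im]
  rw [Complex.sq_norm, Complex.normSq_apply, Complex.sub_re, Complex.sub_im, hre, him,
    Complex.one_re, Complex.one_im]
  have hp := Real.exp_pos (-t)
  have hsq := Real.sin_sq_add_cos_sq θ
  have key : (1 - Real.exp (-t) * Real.cos θ) * (1 - Real.exp (-t) * Real.cos θ) +
      (0 - -(Real.exp (-t) * Real.sin θ)) * (0 - -(Real.exp (-t) * Real.sin θ)) =
      (1 - Real.exp (-t)) ^ 2 + 2 * Real.exp (-t) * (1 - Real.cos θ) := by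
    linear_combination Real.exp (-t) ^ 2 * hsq
  rw [key]
  calc 4 / Real.pi ^ 2 * Real.exp (-t) * θ ^ 2
      = 2 * Real.exp (-t) * (2 / Real.pi ^ 2 * θ ^ 2) := by ring
    _ ≤ 2 * Real.exp (-t) * (1 - Real.cos θ) := by gcongr; linarith
    _ ≤ _ := le_add_of_nonneg_left (sq_nonneg _)

lemma norm_eulerProd_inv_le_of_minor {t θ : ℝ} (ht : 0 < t) (ht' : t ≤ 1 / 10)
    (hθ : |θ| ≤ Real.pi) (hθ' : 2 * t ≤ |θ|) :
    ‖(eulerProd (Complex.exp (-(t + θ * Complex.I))))⁻¹‖ ≤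
      Real.exp ((Real.pi ^ 2 / 6 - 1 / 6) / t) := by
  refine (norm_eulerProd_inv_le ht (norm_exp_neg_ofReal_add_mul_I t θ)).trans
    (Real.exp_le_exp.2 ?_)
  have h1 := norm_one_sub_exp_sq_ge (t := t) hθ
  have h2 : (2 * t) ^ 2 ≤ θ ^ 2 := by
    rw [← sq_abs θ]; gcongr
  have h3 : (9 / 10 : ℝ) ≤ Real.exp (-t) := by
    have := Real.add_one_le_exp (-t)
    linarith
  have hpi : Real.pi ^ 2 ≤ 10 := by nlinarith [Real.pi_lt_d2, Real.pi_pos]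
  -- `36 / 25 = 4 / 10 * (9 / 10) * 2 ^ 2`, from `π² ≤ 10`, `exp (-t) ≥ 9 / 10` and `|θ| ≥ 2 t`.
  have h4 : (36 / 25 : ℝ) * t ^ 2 ≤ ‖1 - Complex.exp (-(t + θ * Complex.I))‖ ^ 2 := by
    refine le_trans ?_ h1
    calc (36 / 25 : ℝ) * t ^ 2 = 4 / 10 * (9 / 10) * (2 * t) ^ 2 := by ring
      _ ≤ 4 / Real.pi ^ 2 * Real.exp (-t) * θ ^ 2 := by gcongr
  have h5 : 6 / 5 * t ≤ ‖1 - Complex.exp (-(t + θ * Complex.I))‖ := by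
    refine le_of_sq_le_sq ?_ (norm_nonneg _)
    linarith [h4, show (6 / 5 * t) ^ 2 = 36 / 25 * t ^ 2 by ring]
  have h6 : 1 / ‖1 - Complex.exp (-(t + θ * Complex.I))‖ ≤ 1 / (6 / 5 * t) := by gcongr
  have h7 : 1 / (6 / 5 * t) = (5 / 6) / t := by field_simp
  calc _ ≤ (5 / 6) / t + (Real.pi ^ 2 / 6 - 1) / t := by rw [← h7]; gcongr
    _ = _ := by ring

/-! ### The modular transformation of Euler's product -/

/-- The eta function at `τ = i w / (2 π)`, for which `exp (2 π i τ) = exp (-w)`. -/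
lemma eta_eq_eulerProd (w : ℂ) :
    ModularForm.eta (Complex.I * w / (2 * Real.pi)) =
      Complex.exp (-w / 24) * eulerProd (Complex.exp (-w)) := by
  have hpi : (Real.pi : ℂ) ≠ 0 := by exact_mod_cast Real.pi_ne_zero
  have h1 : 2 * Real.pi * Complex.I * (Complex.I * w / (2 * Real.pi)) = -w := by
    field_simp
    rw [Complex.I_sq]; ring
  rw [ModularForm.eta, eulerProd, Function.Periodic.qParam, h1]
  simp only [ModularForm.eta_q_eq_pow, h1]
  norm_num

/-- `√(1 + u i)`, in the form in which it appears in the transformation of the eta function. -/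
noncomputable def rotatedSqrt (u : ℝ) : ℂ :=
  (Complex.sqrt Complex.I)⁻¹ * Complex.sqrt (Complex.I * (1 + u * Complex.I))

lemma sqrt_I_ne_zero : Complex.sqrt Complex.I ≠ 0 := by
  simp [Complex.sqrt]

lemma rotatedSqrt_zero : rotatedSqrt 0 = 1 := by
  simp [rotatedSqrt, inv_mul_cancel₀ sqrt_I_ne_zero]

lemma continuous_rotatedSqrt : Continuous rotatedSqrt := by
  refine continuous_const.mul ?_
  refine Complex.continuousOn_sqrt.comp_continuous (by fun_prop) fun u => ?_
  rw [Complex.mem_slitPlane_iff]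
  right
  simp

lemma sqrt_ofReal_mul {r : ℝ} (hr : 0 < r) {z : ℂ} (hz : z ≠ 0) :
    Complex.sqrt (r * z) = √r * Complex.sqrt z := by
  have hr' : (r : ℂ) ≠ 0 := by exact_mod_cast hr.ne'
  rw [Complex.sqrt, Complex.sqrt, Complex.cpow_def_of_ne_zero (mul_ne_zero hr' hz),
    Complex.cpow_def_of_ne_zero hz, Complex.log_ofReal_mul hr hz, add_mul, Complex.exp_add]
  congr 1
  rw [Real.sqrt_eq_rpow, Complex.ofReal_cpow hr.le, Complex.cpow_def_of_ne_zero hr',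
    Complex.ofReal_log hr.le]
  norm_num

/-- The modular transformation of the eta function in terms of `eulerProd`, with
`w = t (1 + u i)`. -/
lemma eulerProd_inv_transform {t : ℝ} (ht : 0 < t) (u : ℝ) :
    (eulerProd (Complex.exp (-(t * (1 + u * Complex.I)))))⁻¹ =
      √(t / (2 * Real.pi)) * rotatedSqrt u * Complex.exp (-(t * (1 + u * Complex.I)) / 24) *
      Complex.exp (Real.pi ^ 2 / 6 / (t * (1 + u * Complex.I))) *
      (eulerProd (Complex.exp (-(4 * Real.pi ^ 2 / (t * (1 + u * Complex.I))))))⁻¹ := by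
  have hpi : (Real.pi : ℂ) ≠ 0 := by exact_mod_cast Real.pi_ne_zero
  have h1u : (1 + u * Complex.I) ≠ 0 := by
    intro h; simpa using congrArg Complex.re h
  have ht' : (t : ℂ) ≠ 0 := by exact_mod_cast ht.ne'
  set w : ℂ := t * (1 + u * Complex.I) with hw
  have hw0 : w ≠ 0 := mul_ne_zero ht' h1u
  have hwre : w.re = t := by simp [hw]
  set τ : ℂ := Complex.I * w / (2 * Real.pi) with hτ
  have hτim : 0 < τ.im := by
    have : τ = ((2 * Real.pi)⁻¹ : ℝ) * (Complex.I * w) := by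
      rw [hτ]; push_cast; field_simp
    rw [this, Complex.im_ofReal_mul]
    simp only [Complex.mul_im, Complex.I_re, Complex.I_im, hwre]
    have := Real.pi_pos
    simp
    positivity
  have hinv : -1 / τ = Complex.I * (4 * Real.pi ^ 2 / w) / (2 * Real.pi) := by
    rw [hτ]; field_simp; rw [Complex.I_sq]; ring
  have hsqrt : Complex.sqrt τ =
      √(t / (2 * Real.pi)) * Complex.sqrt (Complex.I * (1 + u * Complex.I)) := by
    rw [← sqrt_ofReal_mul (by positivity) (mul_ne_zero Complex.I_ne_zero h1u)]
    congr 1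
    rw [hτ, hw]; push_cast; ring
  have h := ModularForm.eta_comp_eq_csqrt_I_inv
    (show τ ∈ UpperHalfPlane.upperHalfPlaneSet from hτim)
  simp only [Function.comp_apply, Pi.smul_apply, Pi.mul_apply, smul_eq_mul] at h
  rw [hinv, eta_eq_eulerProd, hsqrt, hτ, eta_eq_eulerProd] at h
  have hn1 : ‖Complex.exp (-w)‖ < 1 := by
    rw [Complex.norm_exp, Complex.neg_re, hwre]; simpa using ht
  have hn2 : ‖Complex.exp (-(4 * Real.pi ^ 2 / w))‖ < 1 := by
    rw [Complex.norm_exp, Real.exp_lt_one_iff, Complex.neg_re, neg_lt_zero]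
    have : (4 * Real.pi ^ 2 / w) = ((4 * Real.pi ^ 2 : ℝ) : ℂ) / w := by push_cast; rfl
    rw [this, Complex.div_re]
    simp only [Complex.ofReal_re, Complex.ofReal_im, hwre, zero_mul, zero_div, add_zero]
    have := Complex.normSq_pos.2 hw0
    positivity
  have he1 := eulerProd_ne_zero hn1
  have he2 := eulerProd_ne_zero hn2
  have hexp : Complex.exp (Real.pi ^ 2 / 6 / w) *
      Complex.exp (-(4 * Real.pi ^ 2 / w) / 24) = 1 := by
    rw [← Complex.exp_add, ← Complex.exp_zero]
    congr 1; field_simp; ring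
  rw [eq_mul_inv_iff_mul_eq₀ he2, inv_mul_eq_iff_eq_mul₀ he1, rotatedSqrt]
  linear_combination Complex.exp (Real.pi ^ 2 / 6 / w) * h -
    eulerProd (Complex.exp (-(4 * Real.pi ^ 2 / w))) * hexp

/-! ### The circle method -/

/-- The integrand of the circle method at `w = t + θ i`. The exponent `n` is expressed by the radius
parameter as `n = π² / (6 t²)`, which makes `t` the saddle point. -/
noncomputable def arcIntegrand (t θ : ℝ) : ℂ :=
  (eulerProd (Complex.exp (-(t + θ * Complex.I))))⁻¹ *
    Complex.exp (Real.pi ^ 2 / 6 / t ^ 2 * (t + θ * Complex.I))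

lemma continuous_arcIntegrand {t : ℝ} (ht : 0 < t) : Continuous (arcIntegrand t) := by
  refine Continuous.mul (Continuous.inv₀ ?_ fun θ => eulerProd_ne_zero (norm_exp_neg_lt_one ht θ))
    (by fun_prop)
  exact continuousOn_eulerProd.comp_continuous (by fun_prop) fun θ => by
    simpa using norm_exp_neg_lt_one ht θ

lemma integral_arcIntegrand {n : ℕ} (hn : n ≠ 0) :
    ∫ θ in (-Real.pi)..Real.pi, arcIntegrand (Real.pi / √(6 * n)) θ =
      2 * Real.pi * cardOddSimple n := by
  have hn' : (0 : ℝ) < n := by positivity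
  have ht : 0 < Real.pi / √(6 * n) := by have := Real.pi_pos; positivity
  rw [← integral_eulerProd_inv_mul_exp ht]
  have hr : Real.pi ^ 2 / 6 / (Real.pi / √(6 * n)) ^ 2 = n := by
    have := Real.pi_pos
    rw [div_pow, Real.sq_sqrt (by positivity)]
    field_simp
  have hc : (Real.pi : ℂ) ^ 2 / 6 / ((Real.pi / √(6 * n) : ℝ) : ℂ) ^ 2 = n := by
    exact_mod_cast congrArg (fun x : ℝ => (x : ℂ)) hr
  simp only [arcIntegrand, hc]

/-- What remains of the integrand at `θ = t u` after removing its size at the saddle point, written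
in terms of `u` and the rescaled variable `v = √(π² / (6 t)) u`. It tends to `exp (-v ^ 2)` as `t → 0`
with `v` fixed. -/
noncomputable def majorArcFactor (t v : ℝ) (u : ℝ) : ℂ :=
  rotatedSqrt u * Complex.exp (-(t * (1 + u * Complex.I)) / 24) *
    Complex.exp (-(v ^ 2 / (1 + u * Complex.I))) *
    (eulerProd (Complex.exp (-(4 * Real.pi ^ 2 / (t * (1 + u * Complex.I))))))⁻¹

lemma one_add_mul_I_ne_zero (u : ℝ) : (1 + u * Complex.I) ≠ 0 := by
  intro h; simpa using congrArg Complex.re h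

lemma norm_exp_neg_div_one_add_mul_I (r u : ℝ) :
    ‖Complex.exp (-(r / (1 + u * Complex.I)))‖ = Real.exp (-(r / (1 + u ^ 2))) := by
  rw [Complex.norm_exp, Complex.neg_re, Complex.div_re]
  simp [Complex.normSq_apply, pow_two]

lemma arcIntegrand_eq {t : ℝ} (ht : 0 < t) (u : ℝ) :
    arcIntegrand t (t * u) = √(t / (2 * Real.pi)) * Real.exp (Real.pi ^ 2 / 3 / t) *
      majorArcFactor t (√(Real.pi ^ 2 / 6 / t) * u) u := by
  have ht' : (t : ℂ) ≠ 0 := by exact_mod_cast ht.ne'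
  have h1 := one_add_mul_I_ne_zero u
  have hs : ((√(Real.pi ^ 2 / 6 / t) : ℝ) : ℂ) ^ 2 = Real.pi ^ 2 / 6 / t := by
    rw [← Complex.ofReal_pow, Real.sq_sqrt (by positivity)]
    push_cast; rfl
  have he : ((t : ℂ) + (t * u : ℝ) * Complex.I) = t * (1 + u * Complex.I) := by
    push_cast; ring
  -- With `A = π² / (6 t)` this is `(1 + u i)⁻¹ + (1 + u i) = 2 - u² / (1 + u i)`, multiplied
  -- by `A`.
  have hexp : Complex.exp (Real.pi ^ 2 / 6 / (t * (1 + u * Complex.I))) *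
      Complex.exp (Real.pi ^ 2 / 6 / t ^ 2 * (t * (1 + u * Complex.I))) =
      Complex.exp (Real.pi ^ 2 / 3 / t) *
      Complex.exp (-(((√(Real.pi ^ 2 / 6 / t) * u : ℝ) : ℂ) ^ 2 / (1 + u * Complex.I))) := by
    rw [← Complex.exp_add, ← Complex.exp_add]
    congr 1
    push_cast
    rw [mul_pow, hs]
    field_simp
    linear_combination (3 * (u : ℂ) ^ 2) * Complex.I_sq
  rw [arcIntegrand, he, eulerProd_inv_transform ht, majorArcFactor]
  push_cast at hexp ⊢
  linear_combination √(t / (2 * Real.pi)) * rotatedSqrt u *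
    Complex.exp (-(t * (1 + u * Complex.I)) / 24) *
    (eulerProd (Complex.exp (-(4 * Real.pi ^ 2 / (t * (1 + u * Complex.I))))))⁻¹ * hexp

lemma majorArcFactor_mul_eq {t : ℝ} (ht : 0 < t) (v : ℝ) :
    majorArcFactor t v (v / √(Real.pi ^ 2 / 6 / t)) *
      (√(t / (2 * Real.pi)) * Real.exp (Real.pi ^ 2 / 3 / t)) =
      arcIntegrand t (t / √(Real.pi ^ 2 / 6 / t) * v) := by
  have hσ : √(Real.pi ^ 2 / 6 / t) ≠ 0 :=
    (Real.sqrt_pos.2 (by have := Real.pi_pos; positivity)).ne'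
  have h := arcIntegrand_eq ht (v / √(Real.pi ^ 2 / 6 / t))
  rw [mul_div_cancel₀ v hσ] at h
  rw [div_mul_eq_mul_div, mul_div_assoc, h]
  ring

lemma continuous_majorArcFactor {t : ℝ} (ht : 0 < t) :
    Continuous fun v : ℝ => majorArcFactor t v (v / √(Real.pi ^ 2 / 6 / t)) := by
  have hne : ((√(t / (2 * Real.pi)) : ℝ) : ℂ) * (Real.exp (Real.pi ^ 2 / 3 / t) : ℝ) ≠ 0 := by
    have h : √(t / (2 * Real.pi)) * Real.exp (Real.pi ^ 2 / 3 / t) ≠ 0 := by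
      have := Real.pi_pos
      positivity
    exact_mod_cast h
  simp only [eq_div_of_mul_eq hne (majorArcFactor_mul_eq ht _)]
  exact ((continuous_arcIntegrand ht).comp (continuous_const_mul _)).div_const _

/-- The argument of the transformed product is small on the whole major arc. -/
lemma norm_exp_dual_le {t u : ℝ} (ht : 0 < t) (hu : |u| ≤ 2) :
    ‖Complex.exp (-(4 * Real.pi ^ 2 / (t * (1 + u * Complex.I))))‖ ≤ Real.exp (-(1 / t)) := by
  have e : (4 * (Real.pi : ℂ) ^ 2 / (t * (1 + u * Complex.I))) =
      ((4 * Real.pi ^ 2 / t : ℝ) : ℂ) / (1 + u * Complex.I) := by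
    push_cast; rw [div_div]
  rw [e, norm_exp_neg_div_one_add_mul_I, Real.exp_le_exp, neg_le_neg_iff, div_div]
  have hu2 : u ^ 2 ≤ 4 := by
    rw [← sq_abs]; nlinarith [abs_nonneg u]
  have hpi : 5 ≤ 4 * Real.pi ^ 2 := by nlinarith [Real.pi_gt_three]
  rw [div_le_div_iff₀ ht (by positivity)]
  nlinarith

lemma exists_majorArcFactor_bound : ∃ C : ℝ, ∀ t v u : ℝ, 0 < t → t ≤ 1 → |u| ≤ 2 →
    ‖majorArcFactor t v u‖ ≤ C * Real.exp (-(1 / 5) * v ^ 2) := by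
  obtain ⟨R, hR⟩ := (isCompact_Icc (a := (-2 : ℝ)) (b := 2)).exists_bound_of_continuousOn
    continuous_rotatedSqrt.continuousOn
  have hlt : Real.exp (-1) < 1 := by simp
  obtain ⟨B, hB⟩ := (isCompact_closedBall (0 : ℂ) (Real.exp (-1))).exists_bound_of_continuousOn
    (f := fun z => (eulerProd z)⁻¹) (ContinuousOn.inv₀
      (continuousOn_eulerProd.mono (Metric.closedBall_subset_ball hlt)) fun z hz =>
        eulerProd_ne_zero ((mem_closedBall_zero_iff.1 hz).trans_lt hlt))
  refine ⟨R * B, fun t v u ht ht1 hu => ?_⟩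
  have h1 := hR u (abs_le.1 hu)
  have h2 := hB (Complex.exp (-(4 * Real.pi ^ 2 / (t * (1 + u * Complex.I))))) (by
    rw [mem_closedBall_zero_iff]
    refine (norm_exp_dual_le ht hu).trans (Real.exp_le_exp.2 (neg_le_neg ?_))
    rw [le_div_iff₀ ht]; linarith)
  have h3 : ‖Complex.exp (-(t * (1 + u * Complex.I)) / 24)‖ ≤ 1 := by
    rw [Complex.norm_exp, Real.exp_le_one_iff]
    have : (-(t * (1 + u * Complex.I)) / 24).re = -t / 24 := by
      simp
    rw [this]
    linarith
  have h4 : ‖Complex.exp (-((v : ℂ) ^ 2 / (1 + u * Complex.I)))‖ ≤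
      Real.exp (-(1 / 5) * v ^ 2) := by
    rw [← Complex.ofReal_pow, norm_exp_neg_div_one_add_mul_I, Real.exp_le_exp, neg_mul,
      neg_le_neg_iff, one_div_mul_eq_div]
    have hu2 : u ^ 2 ≤ 4 := by
      rw [← sq_abs]; nlinarith [abs_nonneg u]
    gcongr
    linarith
  rw [majorArcFactor, norm_mul, norm_mul, norm_mul]
  have hR0 : 0 ≤ R := (norm_nonneg _).trans h1
  calc _ ≤ R * 1 * Real.exp (-(1 / 5) * v ^ 2) * B := by gcongr
    _ = _ := by ring

lemma tendsto_sqrt_div_atTop : Tendsto (fun t : ℝ => √(Real.pi ^ 2 / 6 / t)) (𝓝[>] 0) atTop := by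
  refine Real.tendsto_sqrt_atTop.comp ?_
  simp only [div_eq_mul_inv _ (_ : ℝ)]
  exact tendsto_inv_nhdsGT_zero.const_mul_atTop (by have := Real.pi_pos; positivity)

lemma tendsto_majorArcFactor {u : ℝ → ℝ} (hu : Tendsto u (𝓝[>] 0) (𝓝 0)) (v : ℝ) :
    Tendsto (fun t => majorArcFactor t v (u t)) (𝓝[>] 0) (𝓝 (Real.exp (-1 * v ^ 2))) := by
  have ht : Tendsto (fun t : ℝ => t) (𝓝[>] 0) (𝓝 0) := tendsto_nhdsWithin_of_tendsto_nhds tendsto_id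
  have huc : Tendsto (fun t => (1 : ℂ) + u t * Complex.I) (𝓝[>] 0) (𝓝 1) := by
    have := ((Complex.continuous_ofReal.tendsto 0).comp hu).mul_const Complex.I |>.const_add 1
    simpa using this
  have htc : Tendsto (fun t : ℝ => (t : ℂ)) (𝓝[>] 0) (𝓝 0) := by
    simpa [Function.comp_def] using (Complex.continuous_ofReal.tendsto 0).comp ht
  have h1 : Tendsto (fun t => rotatedSqrt (u t)) (𝓝[>] 0) (𝓝 1) := by
    simpa [rotatedSqrt_zero, Function.comp_def] using (continuous_rotatedSqrt.tendsto 0).comp hu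
  have h2 : Tendsto (fun t : ℝ => Complex.exp (-(t * (1 + u t * Complex.I)) / 24)) (𝓝[>] 0)
      (𝓝 1) := by
    simpa [Function.comp_def] using
      (Complex.continuous_exp.tendsto _).comp ((htc.mul huc).neg.div_const 24)
  have h3 : Tendsto (fun t : ℝ => Complex.exp (-((v : ℂ) ^ 2 / (1 + u t * Complex.I)))) (𝓝[>] 0)
      (𝓝 (Complex.exp (-((v : ℂ) ^ 2 / 1)))) :=
    (Complex.continuous_exp.tendsto _).comp ((tendsto_const_nhds.div huc one_ne_zero).neg)
  have h4 : Tendsto (fun t : ℝ => Complex.exp (-(4 * Real.pi ^ 2 / (t * (1 + u t * Complex.I)))))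
      (𝓝[>] 0) (𝓝 0) := by
    rw [tendsto_zero_iff_norm_tendsto_zero]
    have hlim : Tendsto (fun t : ℝ => Real.exp (-(1 / t))) (𝓝[>] 0) (𝓝 0) := by
      simp only [one_div]
      exact Real.tendsto_exp_neg_atTop_nhds_zero.comp tendsto_inv_nhdsGT_zero
    refine squeeze_zero' (Eventually.of_forall fun _ => norm_nonneg _) ?_ hlim
    have hev : ∀ᶠ t in 𝓝[>] 0, |u t| ≤ 2 := by
      have := hu.abs.eventually_lt_const (show |(0 : ℝ)| < 2 by norm_num)
      exact this.mono fun _ h => h.le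
    filter_upwards [hev, self_mem_nhdsWithin] with t h1 h2 using norm_exp_dual_le h2 h1
  have h5 : Tendsto (fun t : ℝ => (eulerProd (Complex.exp
      (-(4 * Real.pi ^ 2 / (t * (1 + u t * Complex.I))))))⁻¹) (𝓝[>] 0) (𝓝 1) := by
    have hc : ContinuousAt eulerProd 0 :=
      continuousOn_eulerProd.continuousAt (Metric.ball_mem_nhds 0 one_pos)
    have h0 : eulerProd 0 = 1 := by simp [eulerProd]
    have := (hc.tendsto.comp h4).inv₀ (by rw [h0]; exact one_ne_zero)
    rwa [h0, inv_one] at this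
  have := ((h1.mul h2).mul h3).mul h5
  simp only [one_mul, mul_one, div_one] at this
  rw [show ((Real.exp (-1 * v ^ 2) : ℝ) : ℂ) = Complex.exp (-(v : ℂ) ^ 2) by push_cast; ring_nf]
  exact this

lemma tendsto_integral_majorArcFactor :
    Tendsto (fun t : ℝ => ∫ v in (-(2 * √(Real.pi ^ 2 / 6 / t)))..(2 * √(Real.pi ^ 2 / 6 / t)),
      majorArcFactor t v (v / √(Real.pi ^ 2 / 6 / t))) (𝓝[>] 0) (𝓝 (√Real.pi : ℝ)) := by
  obtain ⟨C, hC⟩ := exists_majorArcFactor_bound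
  have hlim : ∫ v : ℝ, ((Real.exp (-1 * v ^ 2) : ℝ) : ℂ) = (√Real.pi : ℝ) := by
    rw [integral_complex_ofReal, integral_gaussian, div_one]
  have hpos : ∀ᶠ t : ℝ in 𝓝[>] 0, 0 < t ∧ t ≤ 1 := by
    filter_upwards [Ioo_mem_nhdsGT (zero_lt_one' ℝ)] with t ht using ⟨ht.1, ht.2.le⟩
  rw [← hlim]
  have heq : ∀ t : ℝ, ∫ v in (-(2 * √(Real.pi ^ 2 / 6 / t)))..(2 * √(Real.pi ^ 2 / 6 / t)),
      majorArcFactor t v (v / √(Real.pi ^ 2 / 6 / t)) =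
      ∫ v, (Set.Ioc (-(2 * √(Real.pi ^ 2 / 6 / t))) (2 * √(Real.pi ^ 2 / 6 / t))).indicator
        (fun v => majorArcFactor t v (v / √(Real.pi ^ 2 / 6 / t))) v := by
    intro t
    have := Real.sqrt_nonneg (Real.pi ^ 2 / 6 / t)
    rw [intervalIntegral.integral_of_le (by linarith),
      MeasureTheory.integral_indicator measurableSet_Ioc]
  simp only [heq]
  refine MeasureTheory.tendsto_integral_filter_of_dominated_convergence
    (fun v => C * Real.exp (-(1 / 5) * v ^ 2)) ?_ ?_
    ((integrable_exp_neg_mul_sq (by norm_num)).const_mul C) (Eventually.of_forall fun v => ?_)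
  · filter_upwards [hpos] with t ht
    exact (continuous_majorArcFactor ht.1).aestronglyMeasurable.indicator measurableSet_Ioc
  · filter_upwards [hpos] with t ht
    refine Eventually.of_forall fun v => ?_
    have hσ : 0 < √(Real.pi ^ 2 / 6 / t) :=
      Real.sqrt_pos.2 (by have := Real.pi_pos; have := ht.1; positivity)
    by_cases hv : v ∈ Set.Ioc (-(2 * √(Real.pi ^ 2 / 6 / t))) (2 * √(Real.pi ^ 2 / 6 / t))
    · rw [Set.indicator_of_mem hv]
      refine hC _ _ _ ht.1 ht.2 ?_
      rw [abs_div, abs_of_pos hσ, div_le_iff₀ hσ]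
      exact abs_le.2 ⟨hv.1.le, hv.2⟩
    · rw [Set.indicator_of_notMem hv, norm_zero]
      exact (norm_nonneg _).trans (hC t v 0 ht.1 ht.2 (by norm_num))
  · have hu : Tendsto (fun t : ℝ => v / √(Real.pi ^ 2 / 6 / t)) (𝓝[>] 0) (𝓝 0) :=
      tendsto_sqrt_div_atTop.const_div_atTop v
    refine (tendsto_majorArcFactor hu v).congr' ?_
    filter_upwards [tendsto_sqrt_div_atTop.eventually_gt_atTop |v|] with t ht
    rw [Set.indicator_of_mem]
    have := abs_lt.1 ht
    have := abs_nonneg v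
    constructor <;> linarith

lemma integral_majorArc {t : ℝ} (ht : 0 < t) :
    ∫ θ in (-(2 * t))..(2 * t), arcIntegrand t θ = (√3 / (Real.pi * √Real.pi) : ℝ) *
      (t ^ 2 * Real.exp (Real.pi ^ 2 / 3 / t) : ℝ) *
      ∫ v in (-(2 * √(Real.pi ^ 2 / 6 / t)))..(2 * √(Real.pi ^ 2 / 6 / t)),
        majorArcFactor t v (v / √(Real.pi ^ 2 / 6 / t)) := by
  have hpi := Real.pi_pos
  set σ := √(Real.pi ^ 2 / 6 / t) with hσ
  have hσ0 : 0 < σ := Real.sqrt_pos.2 (by positivity)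
  have hsub := intervalIntegral.smul_integral_comp_mul_left (f := arcIntegrand t)
    (a := -(2 * σ)) (b := 2 * σ) (t / σ)
  rw [show t / σ * -(2 * σ) = -(2 * t) by field_simp,
    show t / σ * (2 * σ) = 2 * t by field_simp] at hsub
  have hconst : t / σ * √(t / (2 * Real.pi)) = √3 / (Real.pi * √Real.pi) * t ^ 2 := by
    rw [hσ, Real.sqrt_div (by positivity), Real.sqrt_div (by positivity),
      Real.sqrt_div (by positivity), Real.sqrt_sq hpi.le, Real.sqrt_mul (by norm_num),
      show (6 : ℝ) = 2 * 3 by norm_num, Real.sqrt_mul (by norm_num)]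
    have h2 : √(2 : ℝ) ≠ 0 := by positivity
    have h3 : √t ≠ 0 := (Real.sqrt_pos.2 ht).ne'
    have h4 : √t ^ 2 = t := Real.sq_sqrt ht.le
    field_simp
    rw [h4]
  rw [← hsub]
  simp only [hσ, ← majorArcFactor_mul_eq ht]
  rw [← hσ]
  rw [intervalIntegral.integral_mul_const]
  have hc := congrArg (fun x : ℝ => (x : ℂ)) hconst
  push_cast at hc ⊢
  simp only [Complex.real_smul]
  push_cast
  linear_combination (Complex.exp (Real.pi ^ 2 / 3 / t) *
    ∫ v in (-(2 * σ))..(2 * σ), majorArcFactor t v (v / σ)) * hc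

/-- Here `exp (π² / (3 t))` is the size of the integrand at the saddle point. -/
lemma norm_integral_minorArc_le {t a b : ℝ} (ht : 0 < t) (ht' : t ≤ 1 / 10)
    (hab : ∀ θ ∈ Set.uIoc a b, 2 * t ≤ |θ| ∧ |θ| ≤ Real.pi) :
    ‖∫ θ in a..b, arcIntegrand t θ‖ ≤
      Real.exp (Real.pi ^ 2 / 3 / t) * Real.exp (-(1 / 6) * t⁻¹) * |b - a| := by
  refine intervalIntegral.norm_integral_le_of_norm_le_const fun θ hθ => ?_
  have h1 := norm_eulerProd_inv_le_of_minor ht ht' (hab θ hθ).2 (hab θ hθ).1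
  have h2 : ‖Complex.exp (Real.pi ^ 2 / 6 / t ^ 2 * (t + θ * Complex.I))‖ =
      Real.exp (Real.pi ^ 2 / 6 / t) := by
    have e : (Real.pi : ℂ) ^ 2 / 6 / t ^ 2 = ((Real.pi ^ 2 / 6 / t ^ 2 : ℝ) : ℂ) := by
      push_cast; rfl
    rw [Complex.norm_exp, e, Complex.re_ofReal_mul]
    congr 1
    simp
    field_simp
  rw [arcIntegrand, norm_mul, h2]
  calc _ ≤ Real.exp ((Real.pi ^ 2 / 6 - 1 / 6) / t) * Real.exp (Real.pi ^ 2 / 6 / t) := by gcongr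
    _ = _ := by rw [← Real.exp_add, ← Real.exp_add]; congr 1; field_simp; ring

lemma tendsto_integral_arcIntegrand :
    Tendsto (fun t : ℝ => (∫ θ in (-Real.pi)..Real.pi, arcIntegrand t θ) /
      (t ^ 2 * Real.exp (Real.pi ^ 2 / 3 / t) : ℝ)) (𝓝[>] 0) (𝓝 (√3 / Real.pi : ℝ)) := by
  have hpi := Real.pi_pos
  have hmajor : Tendsto (fun t : ℝ => (∫ θ in (-(2 * t))..(2 * t), arcIntegrand t θ) /
      (t ^ 2 * Real.exp (Real.pi ^ 2 / 3 / t) : ℝ)) (𝓝[>] 0) (𝓝 (√3 / Real.pi : ℝ)) := by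
    have h := tendsto_integral_majorArcFactor.const_mul ((√3 / (Real.pi * √Real.pi) : ℝ) : ℂ)
    rw [← Complex.ofReal_mul, show √3 / (Real.pi * √Real.pi) * √Real.pi = √3 / Real.pi by
      field_simp] at h
    refine h.congr' ?_
    filter_upwards [self_mem_nhdsWithin] with t (ht : 0 < t)
    have hne : ((t ^ 2 * Real.exp (Real.pi ^ 2 / 3 / t) : ℝ) : ℂ) ≠ 0 := by
      exact_mod_cast (by positivity : (t ^ 2 * Real.exp (Real.pi ^ 2 / 3 / t) : ℝ) ≠ 0)
    rw [integral_majorArc ht, eq_div_iff hne]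
    ring
  have hsmall : Tendsto (fun t : ℝ => 2 * Real.pi * (t⁻¹ ^ 2 * Real.exp (-(1 / 6) * t⁻¹)))
      (𝓝[>] 0) (𝓝 0) := by
    have h := (tendsto_rpow_mul_exp_neg_mul_atTop_nhds_zero 2 (1 / 6) (by norm_num)).comp
      tendsto_inv_nhdsGT_zero
    simpa using h.const_mul (2 * Real.pi)
  have hminor : Tendsto (fun t : ℝ => ((∫ θ in (-Real.pi)..Real.pi, arcIntegrand t θ) -
      ∫ θ in (-(2 * t))..(2 * t), arcIntegrand t θ) /
      (t ^ 2 * Real.exp (Real.pi ^ 2 / 3 / t) : ℝ)) (𝓝[>] 0) (𝓝 0) := by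
    refine squeeze_zero_norm' ?_ hsmall
    filter_upwards [Ioo_mem_nhdsGT (show (0 : ℝ) < 1 / 10 by norm_num)] with t ⟨ht, ht1⟩
    have hint (a b : ℝ) : IntervalIntegrable (arcIntegrand t) MeasureTheory.volume a b :=
      (continuous_arcIntegrand ht).intervalIntegrable a b
    have hpi3 := Real.pi_gt_three
    have hsplit : (∫ θ in (-Real.pi)..Real.pi, arcIntegrand t θ) -
        ∫ θ in (-(2 * t))..(2 * t), arcIntegrand t θ =
        (∫ θ in (-Real.pi)..(-(2 * t)), arcIntegrand t θ) +
        ∫ θ in (2 * t)..Real.pi, arcIntegrand t θ := by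
      rw [← intervalIntegral.integral_add_adjacent_intervals (hint (-Real.pi) (-(2 * t)))
        (hint _ _), ← intervalIntegral.integral_add_adjacent_intervals (hint (-(2 * t)) (2 * t))
        (hint _ _)]
      ring
    have h1 := norm_integral_minorArc_le (a := -Real.pi) (b := -(2 * t)) ht ht1.le fun θ hθ => by
      rw [Set.uIoc_of_le (by linarith)] at hθ
      rw [abs_of_nonpos (by linarith [hθ.2])]
      constructor <;> linarith [hθ.1, hθ.2]
    have h2 := norm_integral_minorArc_le (a := 2 * t) (b := Real.pi) ht ht1.le fun θ hθ => by
      rw [Set.uIoc_of_le (by linarith)] at hθ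
      rw [abs_of_nonneg (by linarith [hθ.1])]
      constructor <;> linarith [hθ.1, hθ.2]
    rw [abs_of_nonneg (by linarith)] at h1 h2
    have hM : 0 < t ^ 2 * Real.exp (Real.pi ^ 2 / 3 / t) := by positivity
    rw [hsplit, norm_div, Complex.norm_real, Real.norm_of_nonneg hM.le, div_le_iff₀ hM]
    refine (norm_add_le _ _).trans ((add_le_add h1 h2).trans ?_)
    have e : 2 * Real.pi * (t⁻¹ ^ 2 * Real.exp (-(1 / 6) * t⁻¹)) *
        (t ^ 2 * Real.exp (Real.pi ^ 2 / 3 / t)) =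
        Real.exp (Real.pi ^ 2 / 3 / t) * Real.exp (-(1 / 6) * t⁻¹) * (2 * Real.pi) := by
      field_simp
    rw [e, ← mul_add]
    gcongr
    linarith
  have := hmajor.add hminor
  rw [add_zero] at this
  refine this.congr fun t => ?_
  ring

/-! ### The asymptotic formula -/

/-- The main term of the Hardy–Ramanujan formula for the number of partitions of `n`. -/
noncomputable def hardyRamanujan (n : ℕ) : ℝ :=
  Real.exp (Real.pi * √(2 * (n : ℝ) / 3)) / (4 * √3 * (n : ℝ))

lemma hardyRamanujan_pos {n : ℕ} (hn : n ≠ 0) : 0 < hardyRamanujan n := by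
  unfold hardyRamanujan
  positivity

lemma tendsto_cardOddSimple_div :
    Tendsto (fun n : ℕ => (cardOddSimple n : ℝ) / hardyRamanujan n) atTop (𝓝 1) := by
  have hpi := Real.pi_pos
  have hsqrt : Tendsto (fun n : ℕ => √(6 * (n : ℝ))) atTop atTop :=
    Real.tendsto_sqrt_atTop.comp (tendsto_natCast_atTop_atTop.const_mul_atTop (by norm_num))
  have ht : Tendsto (fun n : ℕ => Real.pi / √(6 * (n : ℝ))) atTop (𝓝[>] 0) := by
    refine tendsto_nhdsWithin_iff.2 ⟨hsqrt.const_div_atTop Real.pi, ?_⟩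
    filter_upwards [hsqrt.eventually_gt_atTop 0] with n hn using div_pos hpi hn
  have h := (Complex.continuous_re.tendsto _).comp (tendsto_integral_arcIntegrand.comp ht)
  have h' := h.mul_const (Real.pi / √3)
  rw [Complex.ofReal_re, show √3 / Real.pi * (Real.pi / √3) = 1 by field_simp] at h'
  refine h'.congr' ?_
  filter_upwards [eventually_ne_atTop 0] with n hn
  have hn' : (0 : ℝ) < n := by positivity
  have hs : √(6 * (n : ℝ)) ^ 2 = 6 * n := Real.sq_sqrt (by positivity)
  have hs0 : 0 < √(6 * (n : ℝ)) := by positivity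
  -- The size `π² / (3 t)` of the exponent at the saddle point is that in the main term.
  have hexp : Real.pi ^ 2 / 3 / (Real.pi / √(6 * n)) = Real.pi * √(2 * (n : ℝ) / 3) := by
    have : √(2 * (n : ℝ) / 3) = √(6 * n) / 3 := by
      rw [show 2 * (n : ℝ) / 3 = 6 * n / 3 ^ 2 by ring, Real.sqrt_div (by positivity),
        Real.sqrt_sq (by norm_num)]
    rw [this]
    field_simp
  simp only [Function.comp_apply]
  rw [integral_arcIntegrand hn, hexp, hardyRamanujan]
  have hcast : (2 * (Real.pi : ℂ) * (cardOddSimple n : ℂ)) =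
      ((2 * Real.pi * cardOddSimple n : ℝ) : ℂ) := by push_cast; rfl
  rw [hcast, ← Complex.ofReal_div, Complex.ofReal_re, div_pow, hs]
  have h3 : √(3 : ℝ) ^ 2 = 3 := Real.sq_sqrt (by norm_num)
  field_simp
  rw [h3]
  ring

lemma tendsto_hardyRamanujan_div_succ :
    Tendsto (fun n : ℕ => hardyRamanujan n / hardyRamanujan (n + 1)) atTop (𝓝 1) := by
  have hroot : Tendsto (fun n : ℕ => √(2 * (n : ℝ) / 3) - √(2 * ((n + 1 : ℕ) : ℝ) / 3)) atTop
      (𝓝 0) := by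
    have hs : Tendsto (fun n : ℕ => √(2 * (n : ℝ) / 3)) atTop atTop := by
      refine Real.tendsto_sqrt_atTop.comp ?_
      exact (tendsto_natCast_atTop_atTop.const_mul_atTop (by norm_num)).atTop_div_const
        (by norm_num)
    refine squeeze_zero_norm' ?_ (hs.const_div_atTop (2 / 3))
    filter_upwards [eventually_ne_atTop 0] with n hn
    have hn' : (0 : ℝ) < n := by positivity
    have ha : 0 < √(2 * (n : ℝ) / 3) := by positivity
    have hb : √(2 * (n : ℝ) / 3) ≤ √(2 * ((n + 1 : ℕ) : ℝ) / 3) := by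
      apply Real.sqrt_le_sqrt
      push_cast
      linarith
    have ha2 : √(2 * (n : ℝ) / 3) ^ 2 = 2 * n / 3 := Real.sq_sqrt (by positivity)
    have hb2 : √(2 * ((n + 1 : ℕ) : ℝ) / 3) ^ 2 = 2 * (n + 1) / 3 := by
      rw [Real.sq_sqrt (by positivity)]
      push_cast
      rfl
    rw [Real.norm_of_nonpos (by linarith), le_div_iff₀ ha]
    nlinarith
  have hexp := (Real.continuous_exp.tendsto _).comp (hroot.const_mul Real.pi)
  rw [mul_zero, Real.exp_zero] at hexp
  have hratio : Tendsto (fun n : ℕ => 1 + 1 / (n : ℝ)) atTop (𝓝 (1 + 0)) :=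
    tendsto_one_div_atTop_nhds_zero_nat.const_add 1
  have := hexp.mul hratio
  rw [add_zero, one_mul] at this
  refine this.congr' ?_
  filter_upwards [eventually_ne_atTop 0] with n hn
  have hn' : (0 : ℝ) < n := by positivity
  simp only [Function.comp_apply, hardyRamanujan]
  rw [mul_sub, Real.exp_sub]
  push_cast
  field_simp

theorem corollary1p4 :
    (fun n : ℕ => (pEv n : ℝ)) ~[atTop]
      (fun n : ℕ => Real.exp (Real.pi * √(2 * (n : ℝ) / 3)) / (4 * √3 * (n : ℝ))) := by
  change (fun n : ℕ => (pEv n : ℝ)) ~[atTop] hardyRamanujan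
  have hne : ∀ᶠ n in atTop, hardyRamanujan n ≠ 0 := by
    filter_upwards [eventually_ne_atTop 0] with n hn using (hardyRamanujan_pos hn).ne'
  rw [isEquivalent_iff_tendsto_one hne]
  refine (tendsto_add_atTop_iff_nat 1).1 ?_
  have hlower := tendsto_cardOddSimple_div.mul tendsto_hardyRamanujan_div_succ
  rw [one_mul] at hlower
  refine tendsto_of_tendsto_of_tendsto_of_le_of_le' hlower
    ((tendsto_add_atTop_iff_nat 1).2 tendsto_cardOddSimple_div) ?_ ?_
  · filter_upwards [eventually_ne_atTop 0] with n hn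
    have h0 := hardyRamanujan_pos hn
    have h1 := hardyRamanujan_pos n.succ_ne_zero
    rw [div_mul_div_cancel₀ h0.ne']
    simp only [Pi.div_apply]
    gcongr
    exact_mod_cast cardOddSimple_le_pEv_succ n
  · filter_upwards with n
    have h1 := hardyRamanujan_pos n.succ_ne_zero
    simp only [Pi.div_apply]
    gcongr
    exact_mod_cast pEv_le_cardOddSimple (n + 1)
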